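/- Let $(M,g)$ be a non-empty smooth Riemannian manifold of dimension $n>2$ with Levi-Civita connection $\nabla$, let $\xi$ be a smooth unit vector field with $\nabla\xi=0$, and put $\pi(X)=g(X,\xi)$. Let $\tilde\nabla$ be the projective semi-symmetric connection $$\tilde\nabla_XY=\nabla_XY+\psi(Y)X+\psi(X)Y+\phi(Y)X-\phi(X)Y,\qquad \phi=\tfrac12\pi,\quad \psi=\tfrac{n-1}{2(n+1)}\pi .$$ For a connection $D$ write $R^D(X,Y)Z=D_XD_YZ-D_YD_XZ-D_{[X,Y]}Z$ and $S^D(Y,Z)=\operatorname{tr}(X\mapsto R^D(X,Y)Z)$; let $R,S$ belong to $\nabla$ and $\tilde R,\tilde S$ to $\tilde\nabla$. Put $\lambda=-\frac{n^2}{(n+1)^2}$ and let $P(X,Y)Z=R(X,Y)Z-\frac1{n-1}\{S(Y,Z)X-S(X,Z)Y\}$ be the projective curvature tensor of $\nabla$. Then: (a) $\tilde R(X,Y)Z=R(X,Y)Z+\lambda\{\pi(X)\pi(Z)Y-\pi(Y)\pi(Z)X\}$ and $\tilde S(Y,Z)=S(Y,Z)-\lambda(n-1)\pi(Y)\pi(Z)$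 for all $X,Y,Z$. (b) For all tangent vectors $X,Y,Z$ at a point: if $\tilde S(Y,Z)=0$, then $S(Y,Z)=\lambda(n-1)\pi(Y)\pi(Z)$; if moreover $\tilde S(X,Z)=0$, then $\tilde R(X,Y)Z=P(X,Y)Z$. (c) In particular, if $M$ is Ricci flat with respect to $\tilde\nabla$, i.e. $\tilde S=0$, then $S=\lambda(n-1)\,\pi\otimes\pi$; $M$ is quasi-Einstein with generator $\xi$ and associated functions $a=0$, $b=\lambda(n-1)$; and $\tilde R=P$. Here $(M,g)$, of dimension $n>2$, is called quasi-Einstein with generator the unit field $\xi$ and smooth functions $a$, $b$ ($b$ nowhere zero) if $R$ and $S$ are not identically zero and $S=a\,g+b\,\pi\otimes\pi$. (The hypothesis $\tilde S=0$ of (c) cannot hold at any point, because $\tilde S(\xi,\xi)=\frac{n^2(n-1)}{(n+1)^2}\ne0$; the content of the result is in (a) and (b).) -/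

import Mathlib

open Bundle FiberBundle
open scoped Manifold ContDiff

noncomputable section

namespace ProjSemiSymm

/-- A linear (affine) connection on an `n`-dimensional manifold: a covariant derivative on the
tangent bundle. In Mathlib's argument order `D Y x v` is `(∇_v Y)(x)`. -/
abbrev LinearConnection (n : ℕ) (M : Type*) [TopologicalSpace M]
    [ChartedSpace (EuclideanSpace ℝ (Fin n)) M] [IsManifold (𝓡 n) ∞ M] :=
  CovariantDerivative (𝓡 n) (EuclideanSpace ℝ (Fin n)) (fun x : M ↦ TangentSpace (𝓡 n) x)

section Curvature

variable {n : ℕ} {M : Type*} [TopologicalSpace M]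
  [ChartedSpace (EuclideanSpace ℝ (Fin n)) M] [IsManifold (𝓡 n) ∞ M]

/-- The vector field `∇_X ∇_Y Z - ∇_Y ∇_X Z - ∇_{[X, Y]} Z`. -/
def curvatureField (D : LinearConnection n M) (X Y Z : Π x : M, TangentSpace (𝓡 n) x) (x : M) :
    TangentSpace (𝓡 n) x :=
  D (fun y ↦ D Z y (Y y)) x (X x) - D (fun y ↦ D Z y (X y)) x (Y x)
    - D Z x (VectorField.mlieBracket (𝓡 n) X Y x)

/-- The curvature tensor `R(u, v)w` of a connection at the point `x`. The tangent vectors are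
extended to vector fields that are smooth near `x` (with constant coordinates in the preferred
chart at `x`); by tensoriality of the curvature of a smooth connection the value does not depend
on the extension. -/
def curvature (D : LinearConnection n M) (x : M) (u v w : TangentSpace (𝓡 n) x) :
    TangentSpace (𝓡 n) x :=
  curvatureField D (extend (EuclideanSpace ℝ (Fin n)) u) (extend (EuclideanSpace ℝ (Fin n)) v)
    (extend (EuclideanSpace ℝ (Fin n)) w) x

/-- A basis of the tangent space at `x`, used only to write a trace. -/
def tangentBasis (n : ℕ) {M : Type*} [TopologicalSpace M]
    [ChartedSpace (EuclideanSpace ℝ (Fin n)) M] (x : M) :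
    Module.Basis (Fin n) ℝ (TangentSpace (𝓡 n) x) :=
  (EuclideanSpace.basisFun (Fin n) ℝ).toBasis

/-- The Ricci tensor `S(v, w) = trace (u ↦ R(u, v)w)` of a connection, the trace being written in
a basis. -/
def ricci (D : LinearConnection n M) (x : M) (v w : TangentSpace (𝓡 n) x) : ℝ :=
  ∑ i, (tangentBasis n x).coord i (curvature D x (tangentBasis n x i) v w)

/-- Ricci flatness with respect to a linear connection. -/
def IsRicciFlat (D : LinearConnection n M) : Prop :=
  ∀ (x : M) (v w : TangentSpace (𝓡 n) x), ricci D x v w = 0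

/-- The Weyl projective curvature tensor
`P(u, v)w = R(u, v)w - (S(v, w)u - S(u, w)v) / (n - 1)`. -/
def projectiveCurvature (D : LinearConnection n M) (x : M) (u v w : TangentSpace (𝓡 n) x) :
    TangentSpace (𝓡 n) x :=
  curvature D x u v w - (1 / ((n : ℝ) - 1)) • (ricci D x v w • u - ricci D x u w • v)

end Curvature

section Riemannian

variable {n : ℕ} {M : Type*} [TopologicalSpace M]
  [ChartedSpace (EuclideanSpace ℝ (Fin n)) M] [IsManifold (𝓡 n) ∞ M]
  [RiemannianBundle (fun x : M ↦ TangentSpace (𝓡 n) x)]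

/-- The Levi-Civita connection: smooth, compatible with the metric and torsion free. -/
structure IsLeviCivita
    [IsContMDiffRiemannianBundle (𝓡 n) ∞ (EuclideanSpace ℝ (Fin n))
      (fun x : M ↦ TangentSpace (𝓡 n) x)]
    (D : LinearConnection n M) : Prop where
  smooth : CovariantDerivative.ContMDiffCovariantDerivative D ∞
  metric :
    haveI : IsContMDiffRiemannianBundle (𝓡 n) 1 (EuclideanSpace ℝ (Fin n))
      (fun x : M ↦ TangentSpace (𝓡 n) x) := IsContMDiffRiemannianBundle.of_le (n := ∞) (by simp)
    D.IsMetricCompatible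
  torsion_free : D.torsion = 0

/-- A smooth vector field of unit length. -/
structure IsUnitField (ξ : Π x : M, TangentSpace (𝓡 n) x) : Prop where
  smooth : ContMDiff (𝓡 n) (𝓡 n).tangent ∞
    (fun x ↦ (⟨x, ξ x⟩ : TangentBundle (𝓡 n) M))
  unit : ∀ x, inner ℝ (ξ x) (ξ x) = 1

/-- A vector field is parallel when `∇ξ = 0`. -/
def IsParallel (D : LinearConnection n M) (ξ : Π x : M, TangentSpace (𝓡 n) x) : Prop :=
  ∀ x, D ξ x = 0

/-- The one-form `π(v) = g(v, ξ)`. -/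
def form (ξ : Π x : M, TangentSpace (𝓡 n) x) (x : M) (v : TangentSpace (𝓡 n) x) : ℝ :=
  inner ℝ v (ξ x)

/-- The one-form `φ = π / 2`. -/
def phi (ξ : Π x : M, TangentSpace (𝓡 n) x) (x : M) (v : TangentSpace (𝓡 n) x) : ℝ :=
  1 / 2 * form ξ x v

/-- The one-form `ψ = (n - 1) / (2 (n + 1)) π`. -/
def psi (ξ : Π x : M, TangentSpace (𝓡 n) x) (x : M) (v : TangentSpace (𝓡 n) x) : ℝ :=
  ((n : ℝ) - 1) / (2 * ((n : ℝ) + 1)) * form ξ x v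

/-- `D'` is the projective semi-symmetric connection attached to `D` and `ξ`:
`∇'_X Y = ∇_X Y + ψ(Y) X + ψ(X) Y + φ(Y) X - φ(X) Y`.
(When `D` is torsion free, `D'` has torsion `π(Y) X - π(X) Y`; and since
`∇'_X X = ∇_X X + 2 ψ(X) X`, both connections have the same geodesics up to parametrization.) -/
def IsProjectiveSemiSymmetric (D D' : LinearConnection n M)
    (ξ : Π x : M, TangentSpace (𝓡 n) x) : Prop :=
  ∀ (Y : Π x : M, TangentSpace (𝓡 n) x) (x : M),
    MDifferentiableAt (𝓡 n) (𝓡 n).tangent (fun y ↦ (⟨y, Y y⟩ : TangentBundle (𝓡 n) M)) x →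
    ∀ v : TangentSpace (𝓡 n) x,
      D' Y x v = D Y x v + psi ξ x (Y x) • v + psi ξ x v • Y x
        + phi ξ x (Y x) • v - phi ξ x v • Y x

/-- A quasi Einstein manifold, where `D` is the Levi-Civita connection: a non-flat Riemannian
manifold of dimension `n > 2` whose Ricci tensor is not identically zero and equals
`a g + b π ⊗ π` with smooth functions `a` and `b ≠ 0`, where `π` is the one-form dual to the unit
vector field `ξ`. -/
structure IsQuasiEinstein (D : LinearConnection n M) (ξ : Π x : M, TangentSpace (𝓡 n) x)
    (a b : M → ℝ) : Prop where
  dim : 2 < n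
  unitField : IsUnitField ξ
  smooth_a : ContMDiff (𝓡 n) 𝓘(ℝ, ℝ) ∞ a
  smooth_b : ContMDiff (𝓡 n) 𝓘(ℝ, ℝ) ∞ b
  b_ne_zero : ∀ x, b x ≠ 0
  not_flat : ∃ (x : M) (u v w : TangentSpace (𝓡 n) x), curvature D x u v w ≠ 0
  ricci_ne_zero : ∃ (x : M) (v w : TangentSpace (𝓡 n) x), ricci D x v w ≠ 0
  ricci_eq : ∀ (x : M) (v w : TangentSpace (𝓡 n) x),
    ricci D x v w = a x * inner ℝ v w + b x * (form ξ x v * form ξ x w)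

end Riemannian

/-- The constant `λ = -n² / (n + 1)²`. -/
def lam (n : ℕ) : ℝ := -((n : ℝ) ^ 2 / ((n : ℝ) + 1) ^ 2)

end ProjSemiSymm

end

/-!
Write the connection as `∇'_X Y = ∇_X Y + α(Y) X + β(X) Y` with `α = ψ + φ` and `β = ψ - φ`, both
constant multiples of `π`. Since `∇π = 0`, the forms `α` and `β` are parallel, so no derivative of
them survives in `R'`; the terms in `β` are symmetric in `X` and `Y` and cancel, which leaves
`R'(X, Y)Z = R(X, Y)Z + α(Y) α(Z) X - α(X) α(Z) Y`. A change `R' = R + B(X, Z) Y - B(Y, Z) X` with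
`B` bilinear does not affect the projective curvature tensor, and `P' = R'` wherever `S'` vanishes.
Finally `α = n / (n + 1) π`, whence `B = -α ⊗ α = λ π ⊗ π`.
-/

namespace ProjSemiSymm

open Filter Topology

section VectorBundle

variable {E : Type*} [NormedAddCommGroup E] [NormedSpace ℝ E]
  {H : Type*} [TopologicalSpace H] {I : ModelWithCorners ℝ E H}
  {M : Type*} [TopologicalSpace M] [ChartedSpace H M]
  {F : Type*} [NormedAddCommGroup F] [NormedSpace ℝ F]
  {V : M → Type*} [TopologicalSpace (TotalSpace F V)]
  [∀ x, TopologicalSpace (V x)] [FiberBundle F V] {x : M}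

lemma mdifferentiableAt_section_congr {σ τ : Π x : M, V x} (hσ : MDiffAt (T% σ) x)
    (h : ∀ᶠ y in 𝓝 x, τ y = σ y) : MDiffAt (T% τ) x :=
  hσ.congr_of_eventuallyEq (h.mono fun y hy ↦ by simp [hy])

variable [∀ x, AddCommGroup (V x)] [∀ x, Module ℝ (V x)]

lemma exists_contMDiff_section_eventuallyEq [VectorBundle ℝ F V] [FiniteDimensional ℝ E]
    [T2Space M] [IsManifold I ∞ M] {k : ℕ∞} {σ : Π x : M, V x}
    (hσ : ∀ᶠ y in 𝓝 x, CMDiffAt k (T% σ) y) :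
    ∃ τ : Π x : M, V x, CMDiff k (T% τ) ∧ ∀ᶠ y in 𝓝 x, τ y = σ y := by
  obtain ⟨U, hUσ, hU, hxU⟩ := eventually_nhds_iff.1 hσ
  obtain ⟨f, -, hf⟩ := (SmoothBumpFunction.nhds_basis_tsupport (I := I) x).mem_iff.1
    (hU.mem_nhds hxU)
  have hfk : CMDiff[U] k f := (f.contMDiff.of_le (mod_cast le_top)).contMDiffOn
  refine ⟨(f : M → ℝ) • σ, hfk.smul_section_of_tsupport hU hf
    fun y hy ↦ (hUσ y hy).contMDiffWithinAt, ?_⟩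
  filter_upwards [f.eventuallyEq_one] with y hy
  simp [hy]

variable [∀ x, IsTopologicalAddGroup (V x)] [∀ x, ContinuousSMul ℝ (V x)]

lemma mdifferentiableAt_covariantDerivative_apply [VectorBundle ℝ F V] [FiniteDimensional ℝ E]
    [T2Space M] [IsManifold I ∞ M] [ContMDiffVectorBundle 1 F V I]
    {D : CovariantDerivative I F V} {k : ℕ∞} (hD : D.ContMDiffCovariantDerivative k) (hk : k ≠ 0)
    {X : Π x : M, TangentSpace I x} (hX : MDiffAt (T% X) x) {σ : Π x : M, V x}
    (hσ : ∀ᶠ y in 𝓝 x, CMDiffAt (k + 1) (T% σ) y) :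
    MDiffAt (T% (fun y ↦ D σ y (X y))) x := by
  obtain ⟨τ, hτ, hτσ⟩ := exists_contMDiff_section_eventuallyEq (k := k + 1) hσ
  have hDτ := contMDiffOn_univ.1 (hD.contMDiff.contMDiff hτ.contMDiffOn)
  have hDτX : MDiffAt (T% (fun y ↦ D τ y (X y))) x :=
    ((hDτ x).mdifferentiableAt (mod_cast hk)).clm_bundle_apply hX
  refine mdifferentiableAt_section_congr hDτX ?_
  filter_upwards [hτσ.eventually_nhds, hσ] with y hy hσy
  rw [D.isCovariantDerivativeOn.congr_of_eventuallyEq ((hτ y).mdifferentiableAt (by simp))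
    (hσy.mdifferentiableAt (by simp)) univ_mem hy]

/-- The one-form `θ` on the bundle `V` is parallel for the connection `D`, that is
`X(θ(σ)) = θ(∇_X σ)`. Regularity of `θ` is encoded by requiring `θ(σ)` to be differentiable
wherever `σ` is. -/
structure IsParallelForm (D : CovariantDerivative I F V) (θ : Π x : M, V x →ₗ[ℝ] ℝ) : Prop where
  mdifferentiableAt {σ : Π x : M, V x} {x : M} (hσ : MDiffAt (T% σ) x) :
    MDiffAt (fun y ↦ θ y (σ y)) x
  mvfderiv_apply {σ : Π x : M, V x} {x : M} (hσ : MDiffAt (T% σ) x) (v : TangentSpace I x) :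
    mvfderiv I (fun y ↦ θ y (σ y)) x v = θ x (D σ x v)

namespace IsParallelForm

variable {D : CovariantDerivative I F V} {θ : Π x : M, V x →ₗ[ℝ] ℝ} {σ τ : Π x : M, V x}

lemma const_smul (hθ : IsParallelForm D θ) (c : ℝ) : IsParallelForm D (c • θ) where
  mdifferentiableAt hσ := (hθ.mdifferentiableAt hσ).const_smul c
  mvfderiv_apply {σ x} hσ v := by
    have h := DFunLike.congr_fun
      (mvfderiv_fun_smul (mdifferentiableAt_const (c := c)) (hθ.mdifferentiableAt hσ)) v
    simpa [mvfderiv_const, hθ.mvfderiv_apply hσ] using h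

lemma mdifferentiableAt_smul [VectorBundle ℝ F V] (hθ : IsParallelForm D θ)
    (hσ : MDiffAt (T% σ) x) (hτ : MDiffAt (T% τ) x) :
    MDiffAt (T% ((fun y ↦ θ y (σ y)) • τ)) x :=
  (hθ.mdifferentiableAt hσ).smul_section hτ

lemma covariantDerivative_smul (hθ : IsParallelForm D θ) (hσ : MDiffAt (T% σ) x)
    (hτ : MDiffAt (T% τ) x) (v : TangentSpace I x) :
    D ((fun y ↦ θ y (σ y)) • τ) x v = θ x (σ x) • D τ x v + θ x (D σ x v) • τ x := by
  rw [D.isCovariantDerivativeOn.leibniz (s := Set.univ) hτ (hθ.mdifferentiableAt hσ)]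
  simp [hθ.mvfderiv_apply hσ]

end IsParallelForm

end VectorBundle

section TangentBundle

variable {E : Type*} [NormedAddCommGroup E] [NormedSpace ℝ E]
  {H : Type*} [TopologicalSpace H] {I : ModelWithCorners ℝ E H}
  {M : Type*} [TopologicalSpace M] [ChartedSpace H M] [IsManifold I 1 M]
  {D D' : CovariantDerivative I E (fun x : M ↦ TangentSpace I x)}

/-- `D'` is the deformation `∇'_X Y = ∇_X Y + α(Y) X + β(X) Y` of `D` by the one-forms `α` and
`β`. As the value of a covariant derivative at a non-differentiable field is junk, only
differentiable `Y` are considered. -/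
def IsOneFormDeformation (D D' : CovariantDerivative I E (fun x : M ↦ TangentSpace I x))
    (α β : Π x : M, TangentSpace I x →ₗ[ℝ] ℝ) : Prop :=
  ∀ ⦃Y : Π x : M, TangentSpace I x⦄ ⦃x : M⦄, MDiffAt (T% Y) x → ∀ v : TangentSpace I x,
    D' Y x v = D Y x v + α x (Y x) • v + β x v • Y x

lemma IsOneFormDeformation.second_covariantDerivative
    {α β : Π x : M, TangentSpace I x →ₗ[ℝ] ℝ} {Z W : Π x : M, TangentSpace I x} {x : M}
    (h : IsOneFormDeformation D D' α β) (hα : IsParallelForm D α) (hβ : IsParallelForm D β)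
    (hW : MDiffAt (T% W) x) (hZ : ∀ᶠ y in 𝓝 x, MDiffAt (T% Z) y)
    (hDZ : MDiffAt (T% (fun y ↦ D Z y (W y))) x) (v : TangentSpace I x) :
    D' (fun y ↦ D' Z y (W y)) x v = D (fun y ↦ D Z y (W y)) x v
      + (α x (Z x) • D W x v + α x (D Z x v) • W x)
      + (β x (W x) • D Z x v + β x (D W x v) • Z x)
      + α x (D' Z x (W x)) • v + β x v • D' Z x (W x) := by
  have hZx := hZ.self_of_nhds
  have hαZ := hα.mdifferentiableAt_smul hZx hW
  have hβW := hβ.mdifferentiableAt_smul hW hZx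
  have hsum := mdifferentiableAt_add_section (mdifferentiableAt_add_section hDZ hαZ) hβW
  have hev : ∀ᶠ y in 𝓝 x, D' Z y (W y) = ((fun y ↦ D Z y (W y))
      + (fun y ↦ α y (Z y)) • W + (fun y ↦ β y (W y)) • Z) y := hZ.mono fun y hy ↦ h hy (W y)
  have hD'Z := mdifferentiableAt_section_congr hsum hev
  rw [h hD'Z, D.isCovariantDerivativeOn.congr_of_eventuallyEq hD'Z hsum univ_mem hev,
    D.isCovariantDerivativeOn.add (s := Set.univ) (mdifferentiableAt_add_section hDZ hαZ) hβW,
    D.isCovariantDerivativeOn.add (s := Set.univ) hDZ hαZ]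
  simp only [add_apply, hα.covariantDerivative_smul hZx hW, hβ.covariantDerivative_smul hW hZx]

end TangentBundle

section Curvature

variable {n : ℕ} {M : Type*} [TopologicalSpace M] [ChartedSpace (EuclideanSpace ℝ (Fin n)) M]
  [IsManifold (𝓡 n) ∞ M] {D D' : LinearConnection n M} {x : M}

namespace IsOneFormDeformation

variable {α β : Π x : M, TangentSpace (𝓡 n) x →ₗ[ℝ] ℝ} {X Y Z : Π x : M, TangentSpace (𝓡 n) x}

lemma curvatureField_eq (h : IsOneFormDeformation D D' α β) (hα : IsParallelForm D α)
    (hβ : IsParallelForm D β)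
    (hX : MDifferentiableAt (𝓡 n) (𝓡 n).tangent (T% X) x)
    (hY : MDifferentiableAt (𝓡 n) (𝓡 n).tangent (T% Y) x)
    (hZ : ∀ᶠ y in 𝓝 x, MDifferentiableAt (𝓡 n) (𝓡 n).tangent (T% Z) y)
    (hDX : MDifferentiableAt (𝓡 n) (𝓡 n).tangent (T% (fun y ↦ D Z y (X y))) x)
    (hDY : MDifferentiableAt (𝓡 n) (𝓡 n).tangent (T% (fun y ↦ D Z y (Y y))) x) :
    curvatureField D' X Y Z x = curvatureField D X Y Z x
      + (α x (Y x) * α x (Z x)) • X x - (α x (X x) * α x (Z x)) • Y x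
      + α x (Z x) • D.torsion x (X x) (Y x) + β x (D.torsion x (X x) (Y x)) • Z x := by
  have hZx := hZ.self_of_nhds
  rw [D.torsion_apply hX hY, curvatureField, h.second_covariantDerivative hα hβ hY hZ hDY,
    h.second_covariantDerivative hα hβ hX hZ hDX, h hZx, h hZx, h hZx]
  simp only [curvatureField, map_add, map_sub, map_smul, smul_eq_mul]
  module

theorem curvature_eq [T2Space M] {k : ℕ∞} (h : IsOneFormDeformation D D' α β)
    (hα : IsParallelForm D α) (hβ : IsParallelForm D β)
    (hD : CovariantDerivative.ContMDiffCovariantDerivative D k) (hk : k ≠ 0)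
    (htor : D.torsion = 0) (u v w : TangentSpace (𝓡 n) x) :
    curvature D' x u v w
      = curvature D x u v w + (α x v * α x w) • u - (α x u * α x w) • v := by
  have hw : ∀ᶠ y in 𝓝 x,
      ContMDiffAt (𝓡 n) (𝓡 n).tangent ∞ (T% (extend (EuclideanSpace ℝ (Fin n)) w)) y := by
    obtain ⟨s, hs, hw⟩ := exists_contMDiffOn_extend (k := ∞) (𝓡 n) (EuclideanSpace ℝ (Fin n)) w
    exact (eventually_mem_nhds_iff.2 hs).mono fun y hy ↦ hw.contMDiffAt hy
  have hwk := hw.mono fun y hy ↦ hy.of_le (show ((k : ℕ∞ω) + 1) ≤ ∞ by exact_mod_cast le_top)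
  have hu := mdifferentiableAt_extend (𝓡 n) (EuclideanSpace ℝ (Fin n)) u
  have hv := mdifferentiableAt_extend (𝓡 n) (EuclideanSpace ℝ (Fin n)) v
  have hcurv := h.curvatureField_eq hα hβ hu hv (hw.mono fun y hy ↦ hy.mdifferentiableAt (by simp))
    (mdifferentiableAt_covariantDerivative_apply hD hk hu hwk)
    (mdifferentiableAt_covariantDerivative_apply hD hk hv hwk)
  simpa [curvature, htor] using hcurv

end IsOneFormDeformation

lemma ricci_eq_add_trace {v w : TangentSpace (𝓡 n) x}
    {L : TangentSpace (𝓡 n) x →ₗ[ℝ] TangentSpace (𝓡 n) x}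
    (hL : ∀ u, curvature D' x u v w = curvature D x u v w + L u) :
    ricci D' x v w = ricci D x v w + LinearMap.trace ℝ _ L := by
  simp only [ricci, hL, map_add, Finset.sum_add_distrib,
    LinearMap.trace_eq_matrix_trace ℝ (tangentBasis n x), Matrix.trace, Matrix.diag_apply,
    LinearMap.toMatrix_apply, Module.Basis.coord_apply]

section ProjectiveDeformation

variable {B : TangentSpace (𝓡 n) x →ₗ[ℝ] TangentSpace (𝓡 n) x →ₗ[ℝ] ℝ}
  (hB : ∀ u v w, curvature D' x u v w = curvature D x u v w + (B u w • v - B v w • u))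

include hB

theorem ricci_eq_of_curvature_eq (v w : TangentSpace (𝓡 n) x) :
    ricci D' x v w = ricci D x v w - ((n : ℝ) - 1) * B v w := by
  let L : TangentSpace (𝓡 n) x →ₗ[ℝ] TangentSpace (𝓡 n) x :=
    (B.flip w).smulRight v - B v w • LinearMap.id
  have hL u : curvature D' x u v w = curvature D x u v w + L u := hB u v w
  have : Module.Finite ℝ (TangentSpace (𝓡 n) x) := .of_basis (tangentBasis n x)
  have hdim : Module.finrank ℝ (TangentSpace (𝓡 n) x) = n := finrank_euclideanSpace_fin
  rw [ricci_eq_add_trace hL, map_sub, map_smul, LinearMap.trace_id, LinearMap.trace_smulRight,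
    hdim, LinearMap.flip_apply, smul_eq_mul]
  ring

theorem projectiveCurvature_eq_of_curvature_eq (hn : n ≠ 1) (u v w : TangentSpace (𝓡 n) x) :
    projectiveCurvature D' x u v w = projectiveCurvature D x u v w := by
  have hn' : (n : ℝ) - 1 ≠ 0 := sub_ne_zero.2 (mod_cast hn)
  simp only [projectiveCurvature, hB u v w, ricci_eq_of_curvature_eq hB]
  match_scalars <;> field_simp <;> ring

end ProjectiveDeformation

lemma projectiveCurvature_eq_curvature {u v w : TangentSpace (𝓡 n) x} (hv : ricci D x v w = 0)
    (hu : ricci D x u w = 0) : projectiveCurvature D x u v w = curvature D x u v w := by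
  simp [projectiveCurvature, hu, hv]

lemma exists_curvature_ne_zero {v w : TangentSpace (𝓡 n) x} (h : ricci D x v w ≠ 0) :
    ∃ u, curvature D x u v w ≠ 0 := by
  by_contra! hcurv
  exact h (by simp [ricci, hcurv])

end Curvature

section Riemannian

variable {n : ℕ} {M : Type*} [TopologicalSpace M] [ChartedSpace (EuclideanSpace ℝ (Fin n)) M]
  [RiemannianBundle (fun x : M ↦ TangentSpace (𝓡 n) x)] {ξ : Π x : M, TangentSpace (𝓡 n) x}

/-- The one-form `π` of `form`, bundled as a linear form on each tangent space. -/
noncomputable def formLinear (ξ : Π x : M, TangentSpace (𝓡 n) x) (x : M) :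
    TangentSpace (𝓡 n) x →ₗ[ℝ] ℝ where
  toFun := form ξ x
  map_add' _ _ := inner_add_left ..
  map_smul' _ _ := real_inner_smul_left ..

lemma formLinear_apply (x : M) (v : TangentSpace (𝓡 n) x) : formLinear ξ x v = form ξ x v := rfl

/-- The symmetric bilinear form `π ⊗ π` on each tangent space. -/
noncomputable def formTensorForm (ξ : Π x : M, TangentSpace (𝓡 n) x) (x : M) :
    TangentSpace (𝓡 n) x →ₗ[ℝ] TangentSpace (𝓡 n) x →ₗ[ℝ] ℝ :=
  (formLinear ξ x).smulRight (formLinear ξ x)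

lemma formTensorForm_apply (x : M) (v w : TangentSpace (𝓡 n) x) :
    formTensorForm ξ x v w = form ξ x v * form ξ x w := rfl

variable [IsManifold (𝓡 n) ∞ M] {D D' : LinearConnection n M}

lemma IsParallel.isParallelForm
    [IsContMDiffRiemannianBundle (𝓡 n) 1 (EuclideanSpace ℝ (Fin n))
      (fun x : M ↦ TangentSpace (𝓡 n) x)]
    (hpar : IsParallel D ξ) (hD : D.IsMetricCompatible)
    (hξ : MDifferentiable (𝓡 n) (𝓡 n).tangent (T% ξ)) :
    IsParallelForm D (formLinear ξ) where
  mdifferentiableAt {_ x} hσ := hσ.inner_bundle (hξ x)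
  mvfderiv_apply {σ x} hσ v := by
    have h := hD.mvfderiv_inner_eq (extend (EuclideanSpace ℝ (Fin n)) v) hσ (hξ x)
    simp only [extend_apply_self, hpar x, zero_apply, inner_zero_right, add_zero] at h
    exact h

lemma IsProjectiveSemiSymmetric.isOneFormDeformation (h : IsProjectiveSemiSymmetric D D' ξ) :
    IsOneFormDeformation D D' ((n / (n + 1) : ℝ) • formLinear ξ)
      ((-1 / (n + 1) : ℝ) • formLinear ξ) := by
  intro Y x hY v
  have hn : (n : ℝ) + 1 ≠ 0 := by positivity
  simp only [h Y x hY v, phi, psi, Pi.smul_apply, LinearMap.smul_apply, formLinear_apply,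
    smul_eq_mul]
  match_scalars <;> field_simp <;> ring

theorem IsProjectiveSemiSymmetric.curvature_eq [T2Space M]
    [IsContMDiffRiemannianBundle (𝓡 n) ∞ (EuclideanSpace ℝ (Fin n))
      (fun x : M ↦ TangentSpace (𝓡 n) x)]
    (h : IsProjectiveSemiSymmetric D D' ξ) (hD : IsLeviCivita D)
    (hξ : MDifferentiable (𝓡 n) (𝓡 n).tangent (T% ξ))
    (hpar : IsParallel D ξ) (x : M) (u v w : TangentSpace (𝓡 n) x) :
    curvature D' x u v w = curvature D x u v w
      + ((lam n • formTensorForm ξ x) u w • v - (lam n • formTensorForm ξ x) v w • u) := by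
  have : IsContMDiffRiemannianBundle (𝓡 n) 1 (EuclideanSpace ℝ (Fin n))
    (fun x : M ↦ TangentSpace (𝓡 n) x) := IsContMDiffRiemannianBundle.of_le (n := ∞) (by simp)
  have hform := hpar.isParallelForm hD.metric hξ
  rw [h.isOneFormDeformation.curvature_eq (hform.const_smul _) (hform.const_smul _)
    (k := ⊤) hD.smooth (by simp) hD.torsion_free]
  simp only [formTensorForm_apply, Pi.smul_apply, LinearMap.smul_apply, formLinear_apply,
    smul_eq_mul, lam]
  match_scalars <;> field_simp

lemma IsUnitField.isQuasiEinstein [Nonempty M] {b : M → ℝ} (hξ : IsUnitField ξ) (hn : 2 < n)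
    (hb : ContMDiff (𝓡 n) 𝓘(ℝ, ℝ) ∞ b) (hb₀ : ∀ x, b x ≠ 0)
    (hric : ∀ x v w, ricci D x v w = b x * (form ξ x v * form ξ x w)) :
    IsQuasiEinstein D ξ (fun _ ↦ 0) b := by
  obtain ⟨x⟩ := ‹Nonempty M›
  have hξξ : ricci D x (ξ x) (ξ x) ≠ 0 := by
    rw [hric, form, hξ.unit]
    simpa using hb₀ x
  obtain ⟨u, hu⟩ := exists_curvature_ne_zero hξξ
  exact
    { dim := hn
      unitField := hξ
      smooth_a := contMDiff_const
      smooth_b := hb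
      b_ne_zero := hb₀
      not_flat := ⟨x, u, _, _, hu⟩
      ricci_ne_zero := ⟨x, _, _, hξξ⟩
      ricci_eq := by simpa using hric }

end Riemannian

lemma lam_mul_sub_one_ne_zero {n : ℕ} (h₀ : n ≠ 0) (h₁ : n ≠ 1) : lam n * ((n : ℝ) - 1) ≠ 0 := by
  have : (n : ℝ) - 1 ≠ 0 := sub_ne_zero.2 (mod_cast h₁)
  have : (n : ℝ) + 1 ≠ 0 := by positivity
  simp [lam, *]

end ProjSemiSymm

theorem theorem2p3 {n : ℕ} (hn : 2 < n) {M : Type*} [TopologicalSpace M] [T2Space M] [Nonempty M]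
    [ChartedSpace (EuclideanSpace ℝ (Fin n)) M] [IsManifold (𝓡 n) ∞ M]
    [RiemannianBundle (fun x : M ↦ TangentSpace (𝓡 n) x)]
    [IsContMDiffRiemannianBundle (𝓡 n) ∞ (EuclideanSpace ℝ (Fin n))
      (fun x : M ↦ TangentSpace (𝓡 n) x)]
    (D D' : ProjSemiSymm.LinearConnection n M) (ξ : Π x : M, TangentSpace (𝓡 n) x)
    (hD : ProjSemiSymm.IsLeviCivita D)
    (hξ : ProjSemiSymm.IsUnitField ξ)
    (hpar : ProjSemiSymm.IsParallel D ξ)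
    (hD' : ProjSemiSymm.IsProjectiveSemiSymmetric D D' ξ) :
    (∀ (x : M) (u v w : TangentSpace (𝓡 n) x),
      ProjSemiSymm.curvature D' x u v w = ProjSemiSymm.curvature D x u v w
        + ProjSemiSymm.lam n •
          ((ProjSemiSymm.form ξ x u * ProjSemiSymm.form ξ x w) • v
            - (ProjSemiSymm.form ξ x v * ProjSemiSymm.form ξ x w) • u)) ∧
    (∀ (x : M) (v w : TangentSpace (𝓡 n) x),
      ProjSemiSymm.ricci D' x v w = ProjSemiSymm.ricci D x v w
        - ProjSemiSymm.lam n * ((n : ℝ) - 1)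
          * (ProjSemiSymm.form ξ x v * ProjSemiSymm.form ξ x w)) ∧
    (∀ (x : M) (v w : TangentSpace (𝓡 n) x), ProjSemiSymm.ricci D' x v w = 0 →
      ProjSemiSymm.ricci D x v w = ProjSemiSymm.lam n * ((n : ℝ) - 1)
        * (ProjSemiSymm.form ξ x v * ProjSemiSymm.form ξ x w)) ∧
    (∀ (x : M) (u v w : TangentSpace (𝓡 n) x),
      ProjSemiSymm.ricci D' x v w = 0 → ProjSemiSymm.ricci D' x u w = 0 →
      ProjSemiSymm.curvature D' x u v w = ProjSemiSymm.projectiveCurvature D x u v w) ∧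
    (ProjSemiSymm.IsRicciFlat D' →
      (∀ (x : M) (v w : TangentSpace (𝓡 n) x),
        ProjSemiSymm.ricci D x v w = ProjSemiSymm.lam n * ((n : ℝ) - 1)
          * (ProjSemiSymm.form ξ x v * ProjSemiSymm.form ξ x w)) ∧
      ProjSemiSymm.IsQuasiEinstein D ξ (fun _ ↦ 0)
        (fun _ ↦ ProjSemiSymm.lam n * ((n : ℝ) - 1)) ∧
      (∀ (x : M) (u v w : TangentSpace (𝓡 n) x),
        ProjSemiSymm.curvature D' x u v w = ProjSemiSymm.projectiveCurvature D x u v w)) := by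
  have hR := hD'.curvature_eq hD (hξ.smooth.mdifferentiable (by simp)) hpar
  have hS (x : M) (v w : TangentSpace (𝓡 n) x) : ProjSemiSymm.ricci D' x v w
      = ProjSemiSymm.ricci D x v w - ProjSemiSymm.lam n * ((n : ℝ) - 1)
        * (ProjSemiSymm.form ξ x v * ProjSemiSymm.form ξ x w) := by
    rw [ProjSemiSymm.ricci_eq_of_curvature_eq (hR x), LinearMap.smul_apply, LinearMap.smul_apply,
      ProjSemiSymm.formTensorForm_apply, smul_eq_mul]
    ring
  have hric (x : M) (v w : TangentSpace (𝓡 n) x) (h : ProjSemiSymm.ricci D' x v w = 0) :=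
    sub_eq_zero.1 ((hS x v w).symm.trans h)
  have hproj (x : M) (u v w : TangentSpace (𝓡 n) x) (hv : ProjSemiSymm.ricci D' x v w = 0)
      (hu : ProjSemiSymm.ricci D' x u w = 0) :=
    (ProjSemiSymm.projectiveCurvature_eq_curvature hv hu).symm.trans
      (ProjSemiSymm.projectiveCurvature_eq_of_curvature_eq (hR x) (by lia) u v w)
  refine ⟨fun x u v w ↦ ?_, hS, hric, hproj, fun h ↦ ?_⟩
  · rw [hR, smul_sub, smul_smul, smul_smul]
    rfl
  · have hric' x v w := hric x v w (h x v w)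
    exact ⟨hric', hξ.isQuasiEinstein hn contMDiff_const
      (fun _ ↦ ProjSemiSymm.lam_mul_sub_one_ne_zero (by lia) (by lia)) hric',
      fun x u v w ↦ hproj x u v w (h x v w) (h x u w)⟩
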